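/- Norms. On $\mathbb R^2$ let $\|z\|=\max\{|z_1|,|z_2|\}$, with the induced norms for linear and bilinear maps, and $B(\rho)=\{z:\|z\|\le\rho\}$. The map. Let $\Phi$ be a smooth area-preserving diffeomorphism of an open set $M\subseteq\mathbb R^2$ onto itself, $0\in M$, of the form $\Phi(z)=Az+f(z)$ with $A=\mathrm{diag}(\lambda_u,1/\lambda_u)$, $\lambda_u>1$, $f(0)=0$, $Df_0=0$; write $\Phi^{-1}(z)=A^{-1}z+\tilde f(z)$. Fix $R>0$ with $B(R)\subseteq M$ and $\eta$ such that on $B(R)$, for $g=f$ and $g=\tilde f$, $$\|g(z)\|\le\eta\|z\|^2,\quad \|Dg_z\|\le\eta\|z\|,\quad \|D^2g_z\|\le\eta,\quad \|g(z')-g(z'')\|\le\eta\max\{\|z'\|,\|z''\|\}\,\|z'-z''\|.$$ Let $\lambda_\Phi,\lambda_{D\Phi}$ be the Lipschitz constants of $\Phi,D\Phi$ on $B(R)$, $\|D\Phi\|=\max_{z\in B(R)}\|D\Phi_z\|$, $\sigma=\min_{z\in B(R)}\min_{\|v\|=1}\|D\Phi_zv\|$, and $$\lambda=\max\Big(\lambda_\Phi,\frac{\|D\Phi\|+\lambda_{D\Phi}}{\sigma}\Big),\qquad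 \alpha=\frac{\ln\lambda}{\ln\lambda+\ln\lambda_u}.$$ Invariant manifolds. Let $0<r_*\le R$ be such that the local stable manifold $W^l_s$ (the points whose forward orbit stays in $B(r_*)$ and tends to $0$) and the local unstable manifold $W^l_u$ (the same for $\Phi^{-1}$) are graphs $W^l_s=\{|z_2|\le r_*,\ z_1=w_s(z_2)\}$, $W^l_u=\{|z_1|\le r_*,\ z_2=w_u(z_1)\}$, where for $g=w_s,w_u$ and $\xi,\xi',\xi''\in[-r_*,r_*]$ we have $|g(\xi)|\le\eta\xi^2$ and $|g(\xi')-g(\xi'')|\le\lambda_w\max\{|\xi'|,|\xi''|\}|\xi'-\xi''|$. Let $W_s$ be the stable manifold of $0$, i.e. the set of $z\in M$ with $\Phi^k(z)\to0$. Data. Let $T$ be a natural number, $\delta=\delta_0/T$ with $$0<\delta_0\le\min\Big(\frac{1}{16\max(1,\eta)^2e^3\lambda_u^2}\Big(1-\frac1{\lambda_u}\Big),\ \frac{r_*}{2}\Big),$$ let $z_s\in W_s$, and let $T_s$ be the least $k\ge0$ with $\Phi^{k}(z_s)\in B(\delta-2\delta^2)$. Assume that $\Phi^{T_s}(z_s)\in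 W^l_s$ and that $\Phi^k(z_s)\in B(R)$ for $0\le k\le T_s$. Let $v\ne0$, $w=D\Phi^{T_s}_{z_s}v$, $w_u=(w_1,0)$, $w_s=(0,w_2)$, and assume $\|w_s\|\le\|w_u\|$. Let $\varepsilon_1>0$ and let $z_\varepsilon\in M$, $\varepsilon\in[0,\varepsilon_1]$, be a continuous curve with $z_0=z_s$, $\|z_s-z_\varepsilon\|=\varepsilon$ and $|\Phi^{T_s}_2(z_\varepsilon)|\le r_*$, such that $$\Delta_\varepsilon=\big|\Phi^{T_s}_1(z_\varepsilon)-w_s(\Phi^{T_s}_2(z_\varepsilon))\big|$$ is strictly increasing on $[0,\varepsilon_1]$. Put $T_\varepsilon=\big\lfloor\frac{1}{\ln\lambda_u}\ln\frac{e\delta}{\Delta_\varepsilon}\big\rfloor$ ($T_\varepsilon=+\infty$ if $\Delta_\varepsilon=0$) and, when $T_\varepsilon$ is a natural number, $\zeta_\varepsilon=\big(\Phi_1^{T_s+T_\varepsilon}(z_\varepsilon),\,w_u(\Phi_1^{T_s+T_\varepsilon}(z_\varepsilon))\big)$. Proposition. Suppose that $$e\delta\lambda_u^{-\alpha(T-T_s)}\le\Delta_{\varepsilon_1},\qquad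 e\lambda_u^{-\alpha(T-T_s)}\le\frac{\sigma^{T_s}\delta_0}{\max(1,\eta)(1+\lambda_w)\lambda^{T_s}T^2},\qquad T>T_s+\frac1{1-\alpha}.$$ Then there is a (necessarily unique) $\varepsilon_0\in[0,\varepsilon_1]$ with $\Delta_{\varepsilon_0}=e\delta\lambda_u^{-\alpha(T-T_s)}$, and for every $\varepsilon\in[0,\varepsilon_0]$ with $\lambda^{T_s}\varepsilon<\delta^2$ and $\Phi^k(z_\varepsilon)\in B(R)$ for $0\le k\le T_s$: (i) if $T_\varepsilon\ge T-T_s$, then $\displaystyle\|D\Phi^T_{z_\varepsilon}v-A^{T-T_s}w\|\le\lambda_u^{T-T_s}\frac{\|w_u\|}{T}$; (ii) if $\alpha(T-T_s)\le T_\varepsilon<T-T_s$ and, with $j=T-T_s-T_\varepsilon$, the points $\Phi^k(\Phi^{T_s+T_\varepsilon}(z_\varepsilon))$ and $\Phi^k(\zeta_\varepsilon)$, $0\le k\le j$, lie in $B(R)$, then $$\frac{\|D\Phi^T_{z_\varepsilon}v\|}{\|D\Phi^T_{z_s}v\|}\le\Big(1+\frac1T\Big)\frac{\|D\Phi^j_{\zeta_\varepsilon}\|}{\lambda_u^j}.$$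 -/

import Mathlib

open Set Filter Topology MeasureTheory
open scoped ContDiff

/- The plane is `ℝ × ℝ`, whose Mathlib norm is `‖(a, b)‖ = max |a| |b|`; norms of linear maps are
the induced operator norms, and `B(ρ) = {z : ‖z‖ ≤ ρ}` is `Metric.closedBall 0 ρ`. -/

/-- The linear saddle `A = diag (lu, 1 / lu)`. -/
noncomputable def saddleLin (lu : ℝ) : (ℝ × ℝ) →L[ℝ] (ℝ × ℝ) :=
  (lu • ContinuousLinearMap.id ℝ ℝ).prodMap (lu⁻¹ • ContinuousLinearMap.id ℝ ℝ)

/-- `Φ` is a smooth area-preserving diffeomorphism of the open invariant set `M ⊆ ℝ²` onto itself,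
with inverse `Ψ`, and `Φ z = A z + f z` with `A = diag (lu, 1 / lu)`, `lu > 1`, and `f` vanishing
at the origin together with its first derivatives. -/
structure IsAreaPreservingSaddle (M : Set (ℝ × ℝ)) (Φ Ψ : ℝ × ℝ → ℝ × ℝ) (lu : ℝ) : Prop where
  isOpen : IsOpen M
  zero_mem : (0 : ℝ × ℝ) ∈ M
  mapsTo : MapsTo Φ M M
  mapsTo_inv : MapsTo Ψ M M
  left_inv : ∀ z ∈ M, Ψ (Φ z) = z
  right_inv : ∀ z ∈ M, Φ (Ψ z) = z
  smooth : ContDiffOn ℝ ∞ Φ M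
  smooth_inv : ContDiffOn ℝ ∞ Ψ M
  area : ∀ S ⊆ M, MeasurableSet S → volume (Φ '' S) = volume S
  one_lt : 1 < lu
  map_zero : Φ 0 = 0
  fderiv_zero : fderiv ℝ Φ 0 = saddleLin lu

/-- `η` is an admissible constant on `B(R)` for the nonlinear part `f` of a map. -/
structure QuadraticBound (f : ℝ × ℝ → ℝ × ℝ) (R η : ℝ) : Prop where
  norm_le : ∀ z ∈ Metric.closedBall (0 : ℝ × ℝ) R, ‖f z‖ ≤ η * ‖z‖ ^ 2
  fderiv_le : ∀ z ∈ Metric.closedBall (0 : ℝ × ℝ) R, ‖fderiv ℝ f z‖ ≤ η * ‖z‖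
  fderiv2_le : ∀ z ∈ Metric.closedBall (0 : ℝ × ℝ) R, ‖fderiv ℝ (fderiv ℝ f) z‖ ≤ η
  sub_le : ∀ z ∈ Metric.closedBall (0 : ℝ × ℝ) R, ∀ z' ∈ Metric.closedBall (0 : ℝ × ℝ) R,
    ‖f z - f z'‖ ≤ η * max ‖z‖ ‖z'‖ * ‖z - z'‖

/-- The (least) Lipschitz constant of `g` on `S`. -/
noncomputable def lipConst {E F : Type*} [NormedAddCommGroup E] [NormedAddCommGroup F]
    (g : E → F) (S : Set E) : ℝ :=
  sInf {K : ℝ | 0 ≤ K ∧ ∀ x ∈ S, ∀ y ∈ S, ‖g x - g y‖ ≤ K * ‖x - y‖}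

/-- `‖DΦ‖`, the maximum of the operator norm of `DΦ_z` over `B(R)`. -/
noncomputable def normD (Φ : ℝ × ℝ → ℝ × ℝ) (R : ℝ) : ℝ :=
  sSup ((fun z => ‖fderiv ℝ Φ z‖) '' Metric.closedBall (0 : ℝ × ℝ) R)

/-- `σ`, the minimum of `‖DΦ_z v‖` over `z ∈ B(R)` and `‖v‖ = 1`. -/
noncomputable def sigmaMin (Φ : ℝ × ℝ → ℝ × ℝ) (R : ℝ) : ℝ :=
  sInf {s : ℝ | ∃ z ∈ Metric.closedBall (0 : ℝ × ℝ) R, ∃ v : ℝ × ℝ, ‖v‖ = 1 ∧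
    s = ‖fderiv ℝ Φ z v‖}

/-- `λ = max (λ_Φ, (‖DΦ‖ + λ_{DΦ}) / σ)`, all constants taken on `B(R)`. -/
noncomputable def lambdaConst (Φ : ℝ × ℝ → ℝ × ℝ) (R : ℝ) : ℝ :=
  max (lipConst Φ (Metric.closedBall (0 : ℝ × ℝ) R))
    ((normD Φ R + lipConst (fderiv ℝ Φ) (Metric.closedBall (0 : ℝ × ℝ) R)) / sigmaMin Φ R)

/-- The stable manifold of the origin for a map of `M` into itself. -/
def stableManifold (M : Set (ℝ × ℝ)) (Φ : ℝ × ℝ → ℝ × ℝ) : Set (ℝ × ℝ) :=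
  {z | z ∈ M ∧ Tendsto (fun k : ℕ => Φ^[k] z) atTop (𝓝 0)}

/-- The local stable manifold of the origin in `B(r)`: the points whose forward orbit stays in
`B(r)` and tends to the origin. The local unstable manifold is that of the inverse map. -/
def localStable (Φ : ℝ × ℝ → ℝ × ℝ) (r : ℝ) : Set (ℝ × ℝ) :=
  {z | (∀ k : ℕ, Φ^[k] z ∈ Metric.closedBall (0 : ℝ × ℝ) r) ∧
    Tendsto (fun k : ℕ => Φ^[k] z) atTop (𝓝 0)}

/-- Estimates on `[-r, r]` for a function whose graph is a local invariant manifold; the first one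
contains `g 0 = 0` and `g' 0 = 0`. -/
structure GraphBound (g : ℝ → ℝ) (r η lw : ℝ) : Prop where
  abs_le : ∀ x ∈ Icc (-r) r, |g x| ≤ η * |x| ^ 2
  sub_le : ∀ x ∈ Icc (-r) r, ∀ y ∈ Icc (-r) r, |g x - g y| ≤ lw * max |x| |y| * |x - y|

/-- The minimum number of iterations after which the orbit of `p` is in `B(ρ)`. -/
noncomputable def entryTime (Φ : ℝ × ℝ → ℝ × ℝ) (p : ℝ × ℝ) (ρ : ℝ) : ℕ :=
  sInf {k : ℕ | Φ^[k] p ∈ Metric.closedBall (0 : ℝ × ℝ) ρ}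

/-- The distance of `p` from its parallel projection `(ws p₂, p₂)` on the local stable manifold. -/
def stableDist (ws : ℝ → ℝ) (p : ℝ × ℝ) : ℝ := |p.1 - ws p.2|

/-- The parallel projection of `p` on the local unstable manifold. -/
def projUnstable (wu : ℝ → ℝ) (p : ℝ × ℝ) : ℝ × ℝ := (p.1, wu p.1)

/-- The integer part of `ln (e δ / Δ) / ln lu`; it is `+∞` when `Δ = 0`. -/
noncomputable def escapeTime (lu δ Δ : ℝ) : WithTop ℤ :=
  open Classical in
  if Δ = 0 then ⊤ else ((⌊Real.log (Real.exp 1 * δ / Δ) / Real.log lu⌋ : ℤ) : WithTop ℤ)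

/-! Near the saddle the derivative of `Φ` differs from `A` by at most `η` times the distance to the
origin, so its products stay close to powers of `A` as long as the sum of these distances along the
orbit is small. An orbit on the local stable manifold decays geometrically; an orbit starting at
distance `d` from it leaves it at a rate close to `lu`. The norms are therefore bounded by a
decaying geometric sequence plus a growing one (`saddle_passage`). While `lu ^ k * d ≤ e δ`, which
is what the escape time encodes, both sequences sum to a multiple of `δ / (1 - lu⁻¹)`. The smallness
of `δ₀ = T δ` then makes the relative error of the tangent map `O(1/T)` (`tangent_passage`,
`tangent_near_saddle`). With `T - Ts` steps this is (i); with `d = 0` it bounds the denominator in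
(ii) from below.

In (ii) the passage ends after `Te` steps at a point `Q`. Seen backwards, the vertical distance from
`Q` to its projection `ζ` on the unstable manifold expands by about `lu` per step and ends at most
`5 δ`, so `‖Q - ζ‖ ≤ 6 δ lu ^ (-Te)` (`dist_projUnstable`). In the last `j` steps the relative
deviation of the tangent maps at `Q` and `ζ` grows at most by `lam ^ j` (`orbit_shadowing`), and `α`
is the threshold that ensures `lam ^ j ≤ lu ^ Te` (`pow_escape_le`). The final deviation is thus at
most `6 δ = O(1/T)`. The same shadowing over the first `Ts` steps transfers the data from `zs` to `z
ε`. -/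

/-! ### The linear saddle. -/

lemma saddleLin_apply (lu : ℝ) (z : ℝ × ℝ) : saddleLin lu z = (lu * z.1, lu⁻¹ * z.2) := by
  ext <;> simp [saddleLin]

lemma saddleLin_pow_apply (lu : ℝ) (n : ℕ) (z : ℝ × ℝ) :
    (saddleLin lu ^ n) z = (lu ^ n * z.1, lu⁻¹ ^ n * z.2) := by
  induction n with
  | zero => simp
  | succ n ih =>
    rw [pow_succ', mul_apply_eq_comp, ih, saddleLin_apply]
    simp only [pow_succ']
    ext <;> simp <;> ring

lemma norm_saddleLin_le {lu : ℝ} (h : 1 < lu) (z : ℝ × ℝ) : ‖saddleLin lu z‖ ≤ lu * ‖z‖ := by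
  have h0 : 0 < lu := by linarith
  have hi : lu⁻¹ ≤ lu := (inv_le_one_of_one_le₀ h.le).trans h.le
  rw [saddleLin_apply, Prod.norm_def, Prod.norm_def]
  simp only [norm_mul, norm_inv, Real.norm_of_nonneg h0.le]
  refine max_le ?_ ?_
  · gcongr; exact le_max_left _ _
  · gcongr; exact le_max_right _ _

lemma norm_saddleLin_pow_le {lu : ℝ} (h : 1 < lu) (n : ℕ) (z : ℝ × ℝ) :
    ‖(saddleLin lu ^ n) z‖ ≤ lu ^ n * ‖z‖ := by
  induction n with
  | zero => simp
  | succ n ih =>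
    rw [pow_succ', mul_apply_eq_comp]
    refine (norm_saddleLin_le h _).trans ?_
    rw [pow_succ', mul_assoc]
    gcongr

lemma QuadraticBound.eta_nonneg {f : ℝ × ℝ → ℝ × ℝ} {R η : ℝ} (hR : 0 ≤ R)
    (h : QuadraticBound f R η) : 0 ≤ η :=
  (ContinuousLinearMap.opNorm_nonneg _).trans (h.fderiv2_le 0 (by simpa using hR))

/-! ### Iterates, the chain rule, and the constants on `B(R)`. -/

namespace IsAreaPreservingSaddle

variable {M : Set (ℝ × ℝ)} {Φ Ψ : ℝ × ℝ → ℝ × ℝ} {lu : ℝ}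

lemma contDiffAt (h : IsAreaPreservingSaddle M Φ Ψ lu) {z : ℝ × ℝ} (hz : z ∈ M) :
    ContDiffAt ℝ ∞ Φ z := h.smooth.contDiffAt (h.isOpen.mem_nhds hz)

lemma differentiableAt (h : IsAreaPreservingSaddle M Φ Ψ lu) {z : ℝ × ℝ} (hz : z ∈ M) :
    DifferentiableAt ℝ Φ z := (h.contDiffAt hz).differentiableAt (by simp)

lemma iterate_mem (h : IsAreaPreservingSaddle M Φ Ψ lu) {z : ℝ × ℝ} (hz : z ∈ M) (k : ℕ) :
    Φ^[k] z ∈ M := h.mapsTo.iterate k hz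

lemma iterate_differentiableAt (h : IsAreaPreservingSaddle M Φ Ψ lu) (k : ℕ) {z : ℝ × ℝ}
    (hz : z ∈ M) : DifferentiableAt ℝ (Φ^[k]) z := by
  induction k with
  | zero => exact differentiableAt_id
  | succ k ih =>
    rw [Function.iterate_succ']
    exact (h.differentiableAt (h.iterate_mem hz k)).comp z ih

lemma fderiv_iterate_add (h : IsAreaPreservingSaddle M Φ Ψ lu) (m k : ℕ) {z : ℝ × ℝ}
    (hz : z ∈ M) (v : ℝ × ℝ) :
    fderiv ℝ (Φ^[m + k]) z v = fderiv ℝ (Φ^[k]) (Φ^[m] z) (fderiv ℝ (Φ^[m]) z v) := by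
  rw [add_comm, Function.iterate_add, fderiv_comp z
    (h.iterate_differentiableAt k (h.iterate_mem hz m)) (h.iterate_differentiableAt m hz)]
  rfl

lemma fderiv_iterate_succ (h : IsAreaPreservingSaddle M Φ Ψ lu) (k : ℕ) {z : ℝ × ℝ}
    (hz : z ∈ M) (v : ℝ × ℝ) :
    fderiv ℝ (Φ^[k + 1]) z v = fderiv ℝ Φ (Φ^[k] z) (fderiv ℝ (Φ^[k]) z v) := by
  simpa using h.fderiv_iterate_add k 1 hz v

lemma inv_iterate_iterate (h : IsAreaPreservingSaddle M Φ Ψ lu) {z : ℝ × ℝ} (hz : z ∈ M)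
    (N : ℕ) : ∀ k ≤ N, Ψ^[k] (Φ^[N] z) = Φ^[N - k] z := by
  intro k hk
  induction k with
  | zero => rfl
  | succ k ih =>
    rw [Function.iterate_succ_apply', ih (by omega), show N - k = N - (k + 1) + 1 by omega,
      Function.iterate_succ_apply', h.left_inv _ (h.iterate_mem hz _)]

/-- Differentiating `Ψ ∘ Φ = id` gives a left inverse of the derivative. -/
lemma fderiv_ne_zero (h : IsAreaPreservingSaddle M Φ Ψ lu) {z v : ℝ × ℝ} (hz : z ∈ M)
    (hv : v ≠ 0) : fderiv ℝ Φ z v ≠ 0 := by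
  intro h0
  have hΨ : DifferentiableAt ℝ Ψ (Φ z) :=
    (h.smooth_inv.contDiffAt (h.isOpen.mem_nhds (h.mapsTo hz))).differentiableAt (by simp)
  have h1 : fderiv ℝ (Ψ ∘ Φ) z = ContinuousLinearMap.id ℝ (ℝ × ℝ) := by
    rw [← fderiv_id (𝕜 := ℝ) (x := z)]
    apply Filter.EventuallyEq.fderiv_eq
    filter_upwards [h.isOpen.mem_nhds hz] with x hx using h.left_inv x hx
  rw [fderiv_comp z hΨ (h.differentiableAt hz)] at h1
  apply hv
  have := congrArg (fun L => L v) h1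
  simpa [h0] using this.symm

lemma continuousOn_fderiv (h : IsAreaPreservingSaddle M Φ Ψ lu) :
    ContinuousOn (fderiv ℝ Φ) M :=
  h.smooth.continuousOn_fderiv_of_isOpen h.isOpen (by simp)

variable {R : ℝ}

lemma sigmaMin_pos (h : IsAreaPreservingSaddle M Φ Ψ lu) (hR : 0 < R)
    (hRM : Metric.closedBall (0 : ℝ × ℝ) R ⊆ M) : 0 < sigmaMin Φ R := by
  have hK : IsCompact (Metric.closedBall (0 : ℝ × ℝ) R ×ˢ Metric.sphere (0 : ℝ × ℝ) 1) :=
    (isCompact_closedBall _ _).prod (isCompact_sphere _ _)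
  have hc : ContinuousOn (fun p : (ℝ × ℝ) × (ℝ × ℝ) => ‖fderiv ℝ Φ p.1 p.2‖)
      (Metric.closedBall (0 : ℝ × ℝ) R ×ˢ Metric.sphere (0 : ℝ × ℝ) 1) := by
    refine ContinuousOn.norm (ContinuousOn.clm_apply ?_ continuousOn_snd)
    exact (h.continuousOn_fderiv.mono hRM).comp continuousOn_fst fun p hp => hp.1
  have h1 : ‖((1 : ℝ), (0 : ℝ))‖ = 1 := by simp [Prod.norm_def]
  obtain ⟨p, hp, hmin⟩ := hK.exists_isMinOn ⟨(0, (1, 0)), by simp [hR.le], by simp [h1]⟩ hc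
  have hp2 : ‖p.2‖ = 1 := by simpa using hp.2
  refine lt_of_lt_of_le (norm_pos_iff.2 (h.fderiv_ne_zero (hRM hp.1) (v := p.2) ?_))
    (le_csInf ⟨_, 0, by simp [hR.le], (1, 0), h1, rfl⟩ ?_)
  · rintro h0; simp [h0] at hp2
  · rintro s ⟨z, hz, v, hv, rfl⟩
    exact hmin (a := (z, v)) ⟨hz, by simpa using hv⟩

lemma sigmaMin_mul_le {z : ℝ × ℝ}
    (hz : z ∈ Metric.closedBall (0 : ℝ × ℝ) R) (v : ℝ × ℝ) :
    sigmaMin Φ R * ‖v‖ ≤ ‖fderiv ℝ Φ z v‖ := by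
  by_cases hv : v = 0
  · simp [hv]
  have hv' : 0 < ‖v‖ := norm_pos_iff.2 hv
  have : sigmaMin Φ R ≤ ‖fderiv ℝ Φ z (‖v‖⁻¹ • v)‖ :=
    csInf_le ⟨0, by rintro _ ⟨_, _, _, _, rfl⟩; positivity⟩
      ⟨z, hz, _, by rw [norm_smul, norm_inv, norm_norm, inv_mul_cancel₀ hv'.ne'], rfl⟩
  rw [map_smul, norm_smul, norm_inv, norm_norm, inv_mul_eq_div, le_div_iff₀ hv'] at this
  exact this

lemma norm_fderiv_le_normD (h : IsAreaPreservingSaddle M Φ Ψ lu)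
    (hRM : Metric.closedBall (0 : ℝ × ℝ) R ⊆ M) {z : ℝ × ℝ}
    (hz : z ∈ Metric.closedBall (0 : ℝ × ℝ) R) : ‖fderiv ℝ Φ z‖ ≤ normD Φ R :=
  le_csSup ((isCompact_closedBall _ _).bddAbove_image (h.continuousOn_fderiv.mono hRM).norm)
    ⟨z, hz, rfl⟩

end IsAreaPreservingSaddle

/-! ### Lipschitz constants and shadowing of orbits. -/

lemma lipConst_nonneg {E F : Type*} [NormedAddCommGroup E] [NormedAddCommGroup F]
    (g : E → F) (S : Set E) : 0 ≤ lipConst g S := Real.sInf_nonneg fun _ h => h.1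

/-- The infimum is itself a Lipschitz constant once some constant exists; `hK` excludes the default
value `sInf ∅ = 0`. -/
lemma norm_sub_le_lipConst {E F : Type*} [NormedAddCommGroup E] [NormedAddCommGroup F]
    {g : E → F} {S : Set E} {K : ℝ} (hK : ∀ x ∈ S, ∀ y ∈ S, ‖g x - g y‖ ≤ K * ‖x - y‖)
    {x y : E} (hx : x ∈ S) (hy : y ∈ S) : ‖g x - g y‖ ≤ lipConst g S * ‖x - y‖ := by
  rcases eq_or_ne x y with rfl | hxy
  · simp
  have hpos : 0 < ‖x - y‖ := norm_pos_iff.2 (sub_ne_zero.2 hxy)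
  rw [← div_le_iff₀ hpos]
  have hK' : ∀ x ∈ S, ∀ y ∈ S, ‖g x - g y‖ ≤ max K 0 * ‖x - y‖ := fun x hx y hy =>
    (hK x hx y hy).trans (by gcongr; exact le_max_left _ _)
  refine le_csInf ⟨max K 0, le_max_right _ _, hK'⟩ ?_
  rintro L ⟨-, hL⟩
  rw [div_le_iff₀ hpos]
  exact hL x hx y hy

namespace IsAreaPreservingSaddle

variable {M : Set (ℝ × ℝ)} {Φ Ψ : ℝ × ℝ → ℝ × ℝ} {lu R : ℝ}

lemma norm_sub_le (h : IsAreaPreservingSaddle M Φ Ψ lu)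
    (hRM : Metric.closedBall (0 : ℝ × ℝ) R ⊆ M) {x y : ℝ × ℝ}
    (hx : x ∈ Metric.closedBall (0 : ℝ × ℝ) R) (hy : y ∈ Metric.closedBall (0 : ℝ × ℝ) R) :
    ‖Φ x - Φ y‖ ≤ lipConst Φ (Metric.closedBall (0 : ℝ × ℝ) R) * ‖x - y‖ := by
  refine norm_sub_le_lipConst (K := normD Φ R) (fun x hx y hy => ?_) hx hy
  exact (convex_closedBall (0 : ℝ × ℝ) R).norm_image_sub_le_of_norm_fderiv_le (𝕜 := ℝ)
    (fun z hz => h.differentiableAt (hRM hz)) (fun z hz => h.norm_fderiv_le_normD hRM hz) hy hx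

lemma norm_fderiv_sub_le (h : IsAreaPreservingSaddle M Φ Ψ lu)
    (hRM : Metric.closedBall (0 : ℝ × ℝ) R ⊆ M) {x y : ℝ × ℝ}
    (hx : x ∈ Metric.closedBall (0 : ℝ × ℝ) R) (hy : y ∈ Metric.closedBall (0 : ℝ × ℝ) R) :
    ‖fderiv ℝ Φ x - fderiv ℝ Φ y‖ ≤
      lipConst (fderiv ℝ Φ) (Metric.closedBall (0 : ℝ × ℝ) R) * ‖x - y‖ := by
  have hC : ContDiffOn ℝ 1 (fderiv ℝ Φ) M := h.smooth.fderiv_of_isOpen h.isOpen (by decide)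
  obtain ⟨K, hK⟩ := (isCompact_closedBall (0 : ℝ × ℝ) R).bddAbove_image
    ((hC.continuousOn_fderiv_of_isOpen h.isOpen le_rfl).mono hRM).norm
  refine norm_sub_le_lipConst (K := K) (fun x hx y hy => ?_) hx hy
  exact (convex_closedBall (0 : ℝ × ℝ) R).norm_image_sub_le_of_norm_fderiv_le (𝕜 := ℝ)
    (fun z hz => (hC.contDiffAt (h.isOpen.mem_nhds (hRM hz))).differentiableAt (by simp))
    (fun z hz => hK ⟨z, hz, rfl⟩) hy hx

/-- A Lipschitz constant near the origin dominates the norm of the derivative `A` there, which is at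
least `lu`. -/
lemma le_lambdaConst (h : IsAreaPreservingSaddle M Φ Ψ lu) (hR : 0 < R)
    (hRM : Metric.closedBall (0 : ℝ × ℝ) R ⊆ M) : lu ≤ lambdaConst Φ R := by
  refine le_trans ?_ (le_max_left _ _)
  have hd : HasFDerivAt Φ (saddleLin lu) 0 := by
    rw [← h.fderiv_zero]; exact (h.differentiableAt h.zero_mem).hasFDerivAt
  have h1 : ‖saddleLin lu‖ ≤ lipConst Φ (Metric.closedBall (0 : ℝ × ℝ) R) := by
    refine hd.le_of_lip' (lipConst_nonneg _ _) ?_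
    filter_upwards [Metric.closedBall_mem_nhds (0 : ℝ × ℝ) hR] with x hx
    exact h.norm_sub_le hRM hx (by simp [hR.le])
  refine le_trans ?_ h1
  have h2 := (saddleLin lu).le_opNorm (1, 0)
  have h0 : 0 < lu := by linarith [h.one_lt]
  simpa [saddleLin_apply, Prod.norm_def, abs_of_pos h0, h0.le] using h2

/-- Along two orbits in `B(R)`, the relative deviation of the tangent maps grows at most by the
factor `λ` in each iteration. -/
lemma orbit_shadowing (h : IsAreaPreservingSaddle M Φ Ψ lu) (hR : 0 < R)
    (hRM : Metric.closedBall (0 : ℝ × ℝ) R ⊆ M) {x y : ℝ × ℝ} {m : ℕ}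
    (hx : ∀ k ≤ m, Φ^[k] x ∈ Metric.closedBall (0 : ℝ × ℝ) R)
    (hy : ∀ k ≤ m, Φ^[k] y ∈ Metric.closedBall (0 : ℝ × ℝ) R) (v : ℝ × ℝ) :
    ∀ k ≤ m, ‖Φ^[k] x - Φ^[k] y‖ ≤ lambdaConst Φ R ^ k * ‖x - y‖ ∧
      ‖fderiv ℝ (Φ^[k]) x v - fderiv ℝ (Φ^[k]) y v‖ ≤
        lambdaConst Φ R ^ k * ‖x - y‖ * ‖fderiv ℝ (Φ^[k]) y v‖ := by
  have hxM : x ∈ M := hRM (hx 0 (Nat.zero_le _))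
  have hyM : y ∈ M := hRM (hy 0 (Nat.zero_le _))
  have hσ := h.sigmaMin_pos hR hRM
  set lam := lambdaConst Φ R with hlam
  set σ := sigmaMin Φ R
  set LD := lipConst (fderiv ℝ Φ) (Metric.closedBall (0 : ℝ × ℝ) R)
  have hlam0 : 0 ≤ lam := by linarith [h.le_lambdaConst hR hRM, h.one_lt]
  have hlam1 : lipConst Φ (Metric.closedBall (0 : ℝ × ℝ) R) ≤ lam := le_max_left _ _
  have hlam2 : normD Φ R + LD ≤ lam * σ := by
    rw [← div_le_iff₀ hσ]; exact le_max_right _ _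
  intro k
  induction k with
  | zero => intro _; simp; positivity
  | succ k ih =>
    intro hk
    obtain ⟨ih1, ih2⟩ := ih (by omega)
    have hxk := hx k (by omega)
    have hyk := hy k (by omega)
    constructor
    · rw [Function.iterate_succ_apply', Function.iterate_succ_apply', pow_succ', mul_assoc]
      exact (h.norm_sub_le hRM hxk hyk).trans (by gcongr)
    · rw [h.fderiv_iterate_succ k hxM, h.fderiv_iterate_succ k hyM]
      set a := fderiv ℝ (Φ^[k]) x v
      set b := fderiv ℝ (Φ^[k]) y v
      set E := lam ^ k * ‖x - y‖
      have hE : 0 ≤ E := by positivity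
      have e1 : fderiv ℝ Φ (Φ^[k] x) a - fderiv ℝ Φ (Φ^[k] y) b =
          fderiv ℝ Φ (Φ^[k] x) (a - b) + (fderiv ℝ Φ (Φ^[k] x) - fderiv ℝ Φ (Φ^[k] y)) b := by
        simp
      have hLD : 0 ≤ LD := lipConst_nonneg _ _
      -- This makes the error relative: `‖b‖` is traded for the norm of its image at the cost of `1
      -- / σ`, which explains the quotient in `λ`.
      have hb := sigmaMin_mul_le (Φ := Φ) hyk b
      calc ‖fderiv ℝ Φ (Φ^[k] x) a - fderiv ℝ Φ (Φ^[k] y) b‖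
          ≤ normD Φ R * (E * ‖b‖) + LD * E * ‖b‖ := by
            rw [e1]
            refine (norm_add_le _ _).trans (add_le_add ?_ ?_)
            · refine ((fderiv ℝ Φ (Φ^[k] x)).le_opNorm _).trans ?_
              have := h.norm_fderiv_le_normD hRM hxk
              have h0 := (norm_nonneg _).trans this
              gcongr
            · refine (ContinuousLinearMap.le_opNorm _ _).trans ?_
              gcongr
              exact (h.norm_fderiv_sub_le hRM hxk hyk).trans (by gcongr)
        _ = (normD Φ R + LD) * (E * ‖b‖) := by ring
        _ ≤ lam * σ * (E * ‖b‖) := by gcongr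
        _ = lam * E * (σ * ‖b‖) := by ring
        _ ≤ lam * E * ‖fderiv ℝ Φ (Φ^[k] y) b‖ := by gcongr
        _ = _ := by simp only [E]; ring

end IsAreaPreservingSaddle

/-! ### Decay on the local invariant manifolds. -/

/-- While `a k ≤ D`, the contraction factor is at most `lu⁻¹ + η D ≤ lu⁻¹ + (1 - lu⁻¹) / 10`, which
is the stated rate; the decay in turn preserves `a k ≤ D`. -/
lemma quadratic_contraction_decay {a : ℕ → ℝ} {lu η D : ℝ} (hlu : 1 < lu) (hη : 0 ≤ η)
    (ha : ∀ k, 0 ≤ a k) (h0 : a 0 ≤ D) (hD : 10 * (η * D) ≤ 1 - lu⁻¹)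
    (hstep : ∀ k, a k ≤ D → a (k + 1) ≤ lu⁻¹ * a k + η * a k ^ 2) (k : ℕ) :
    a k ≤ D * (1 - 9 / 10 * (1 - lu⁻¹)) ^ k := by
  have hi : 0 < lu⁻¹ := inv_pos.2 (by linarith)
  have hi1 : lu⁻¹ < 1 := inv_lt_one_of_one_lt₀ hlu
  have hD0 : 0 ≤ D := (ha 0).trans h0
  set μ := 1 - 9 / 10 * (1 - lu⁻¹) with hμ
  have hμ0 : 0 ≤ μ := by linarith
  have hμ1 : μ ≤ 1 := by linarith
  induction k with
  | zero => simpa using h0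
  | succ k ih =>
    have hk : a k ≤ D := ih.trans (mul_le_of_le_one_right hD0 (pow_le_one₀ hμ0 hμ1))
    have h1 : η * a k ≤ η * D := by gcongr
    calc a (k + 1) ≤ lu⁻¹ * a k + η * a k ^ 2 := hstep k hk
      _ = (lu⁻¹ + η * a k) * a k := by ring
      _ ≤ μ * (D * μ ^ k) := by
        refine mul_le_mul (by linarith) ih (ha k) hμ0
      _ = D * μ ^ (k + 1) := by ring

lemma iterate_mem_localStable {Φ : ℝ × ℝ → ℝ × ℝ} {r : ℝ} {s : ℝ × ℝ}
    (hs : s ∈ localStable Φ r) (k : ℕ) : Φ^[k] s ∈ localStable Φ r := by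
  refine ⟨fun m => ?_, ?_⟩
  · rw [← Function.iterate_add_apply]; exact hs.1 _
  · simp only [← Function.iterate_add_apply]
    exact hs.2.comp (tendsto_add_atTop_nat k)

lemma graph_norm_le {η x y : ℝ} (h : |y| ≤ η * |x| ^ 2) (hx : η * |x| ≤ 1) : |y| ≤ |x| := by
  have := mul_le_of_le_one_left (abs_nonneg x) hx
  nlinarith

/-- Orbits on the local stable manifold decay geometrically. -/
lemma localStable_decay {Φ : ℝ × ℝ → ℝ × ℝ} {lu R η r lw D : ℝ} {ws : ℝ → ℝ}
    (hlu : 1 < lu) (hη0 : 0 ≤ η) (hη : QuadraticBound (fun z => Φ z - saddleLin lu z) R η)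
    (hrR : r ≤ R) (hWs : localStable Φ r = {z | |z.2| ≤ r ∧ z.1 = ws z.2})
    (hws : GraphBound ws r η lw) (hD : 10 * (η * D) ≤ 1 - lu⁻¹) {s : ℝ × ℝ}
    (hs : s ∈ localStable Φ r) (hsD : |s.2| ≤ D) (k : ℕ) :
    ‖Φ^[k] s‖ ≤ D * (1 - 9 / 10 * (1 - lu⁻¹)) ^ k := by
  have hi : 0 < lu⁻¹ := inv_pos.2 (by linarith)
  have hμ0 : 0 ≤ 1 - 9 / 10 * (1 - lu⁻¹) := by linarith
  have hμ1 : 1 - 9 / 10 * (1 - lu⁻¹) ≤ 1 := by linarith [inv_lt_one_of_one_lt₀ hlu]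
  have hD0 : 0 ≤ D := (abs_nonneg _).trans hsD
  -- The graph is flat near the origin, so the norm is the vertical coordinate and a scalar
  -- recursion suffices.
  have hnorm : ∀ k, |(Φ^[k] s).2| ≤ D → ‖Φ^[k] s‖ ≤ |(Φ^[k] s).2| := by
    intro k hk
    have hm := iterate_mem_localStable hs k
    rw [hWs] at hm
    refine max_le ?_ le_rfl
    rw [hm.2]
    refine graph_norm_le (hws.abs_le _ (abs_le.1 hm.1)) ?_
    have : η * |(Φ^[k] s).2| ≤ η * D := by gcongr
    linarith
  have key := quadratic_contraction_decay (a := fun k => |(Φ^[k] s).2|) hlu hη0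
    (fun _ => abs_nonneg _) hsD hD (fun k hk => by
      have h1 := hη.norm_le _ (Metric.closedBall_subset_closedBall hrR (hs.1 k))
      have h2 := hnorm k hk
      have h3 : |(Φ (Φ^[k] s) - saddleLin lu (Φ^[k] s)).2| ≤ η * |(Φ^[k] s).2| ^ 2 :=
        (norm_snd_le _).trans (h1.trans (by gcongr))
      simp only [Function.iterate_succ_apply', Prod.snd_sub, saddleLin_apply] at h3 ⊢
      have h4 := abs_sub_abs_le_abs_sub (Φ (Φ^[k] s)).2 (lu⁻¹ * (Φ^[k] s).2)
      rw [abs_mul, abs_of_pos hi] at h4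
      linarith) k
  refine (hnorm k (key.trans ?_)).trans key
  exact mul_le_of_le_one_right hD0 (pow_le_one₀ hμ0 hμ1)

/-- Backward orbits on the local unstable manifold decay geometrically. -/
lemma localUnstable_decay {Ψ : ℝ × ℝ → ℝ × ℝ} {lu R η r lw D : ℝ} {wu : ℝ → ℝ}
    (hlu : 1 < lu) (hη0 : 0 ≤ η) (hη : QuadraticBound (fun z => Ψ z - saddleLin lu⁻¹ z) R η)
    (hrR : r ≤ R) (hWu : localStable Ψ r = {z | |z.1| ≤ r ∧ z.2 = wu z.1})
    (hwu : GraphBound wu r η lw) (hD : 10 * (η * D) ≤ 1 - lu⁻¹) {s : ℝ × ℝ}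
    (hs : s ∈ localStable Ψ r) (hsD : |s.1| ≤ D) (k : ℕ) :
    ‖Ψ^[k] s‖ ≤ D * (1 - 9 / 10 * (1 - lu⁻¹)) ^ k := by
  have hi : 0 < lu⁻¹ := inv_pos.2 (by linarith)
  have hμ0 : 0 ≤ 1 - 9 / 10 * (1 - lu⁻¹) := by linarith
  have hμ1 : 1 - 9 / 10 * (1 - lu⁻¹) ≤ 1 := by linarith [inv_lt_one_of_one_lt₀ hlu]
  have hD0 : 0 ≤ D := (abs_nonneg _).trans hsD
  have hnorm : ∀ k, |(Ψ^[k] s).1| ≤ D → ‖Ψ^[k] s‖ ≤ |(Ψ^[k] s).1| := by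
    intro k hk
    have hm := iterate_mem_localStable hs k
    rw [hWu] at hm
    refine max_le le_rfl ?_
    rw [hm.2]
    refine graph_norm_le (hwu.abs_le _ (abs_le.1 hm.1)) ?_
    have : η * |(Ψ^[k] s).1| ≤ η * D := by gcongr
    linarith
  have key := quadratic_contraction_decay (a := fun k => |(Ψ^[k] s).1|) hlu hη0
    (fun _ => abs_nonneg _) hsD hD (fun k hk => by
      have h1 := hη.norm_le _ (Metric.closedBall_subset_closedBall hrR (hs.1 k))
      have h2 := hnorm k hk
      have h3 : |(Ψ (Ψ^[k] s) - saddleLin lu⁻¹ (Ψ^[k] s)).1| ≤ η * |(Ψ^[k] s).1| ^ 2 :=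
        (norm_fst_le _).trans (h1.trans (by gcongr))
      simp only [Function.iterate_succ_apply', Prod.fst_sub, saddleLin_apply] at h3 ⊢
      have h4 := abs_sub_abs_le_abs_sub (Ψ (Ψ^[k] s)).1 (lu⁻¹ * (Ψ^[k] s).1)
      rw [abs_mul, abs_of_pos hi] at h4
      linarith) k
  refine (hnorm k (key.trans ?_)).trans key
  exact mul_le_of_le_one_right hD0 (pow_le_one₀ hμ0 hμ1)

/-! ### Passage near the saddle. -/

/-- A bound for the norms along an orbit which starts at distance `d` from the local stable
manifold of the saddle. -/
noncomputable def passageBound (lu δ d : ℝ) (k : ℕ) : ℝ :=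
  δ * (1 - 9 / 10 * (1 - lu⁻¹)) ^ k + 11 / 10 * (lu ^ k * d)

lemma sum_geom_contraction_le {lu : ℝ} (hlu : 1 < lu) (k : ℕ) :
    (1 - lu⁻¹) * ∑ i ∈ Finset.range k, (1 - 9 / 10 * (1 - lu⁻¹)) ^ i ≤ 10 / 9 := by
  have hi : 0 < lu⁻¹ := inv_pos.2 (by linarith)
  have hμ0 : 0 ≤ 1 - 9 / 10 * (1 - lu⁻¹) := by linarith
  have h := mul_neg_geom_sum (1 - 9 / 10 * (1 - lu⁻¹)) k
  have := pow_nonneg hμ0 k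
  linarith

lemma passageBound_nonneg {lu δ d : ℝ} (hlu : 1 < lu) (hδ : 0 ≤ δ) (hd : 0 ≤ d) (k : ℕ) :
    0 ≤ passageBound lu δ d k := by
  have hi : 0 < lu⁻¹ := inv_pos.2 (by linarith)
  have hμ0 : 0 ≤ 1 - 9 / 10 * (1 - lu⁻¹) := by linarith
  unfold passageBound; positivity

/-- The decaying part contributes at most `10/9 δ`, the growing part, dominated by its last term, at
most `1.1 * 2.72 δ`. Hence the bound does not depend on the length of the passage. -/
lemma sum_passageBound_le {lu δ d : ℝ} {N : ℕ} (hlu : 1 < lu) (hδ : 0 ≤ δ) (hd : 0 ≤ d)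
    (hN : lu ^ N * d ≤ 272 / 100 * δ) {k : ℕ} (hk : k ≤ N + 1) :
    (1 - lu⁻¹) * ∑ i ∈ Finset.range k, passageBound lu δ d i ≤ 5 * δ := by
  have h0 : 0 < lu := by linarith
  simp only [passageBound, Finset.sum_add_distrib, ← Finset.mul_sum, ← Finset.sum_mul]
  have h1 := mul_le_mul_of_nonneg_left (sum_geom_contraction_le hlu k) hδ
  have h2 : (1 - lu⁻¹) * ∑ i ∈ Finset.range k, lu ^ i ≤ lu ^ N := by
    have h3 := mul_geom_sum lu k
    have h4 : (1 - lu⁻¹) * ∑ i ∈ Finset.range k, lu ^ i = lu⁻¹ * (lu ^ k - 1) := by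
      rw [← h3]; field_simp
    rw [h4]
    calc lu⁻¹ * (lu ^ k - 1) ≤ lu⁻¹ * lu ^ (N + 1) := by
          have : lu ^ k ≤ lu ^ (N + 1) := pow_le_pow_right₀ hlu.le hk
          gcongr; linarith
      _ = lu ^ N := by rw [pow_succ]; field_simp
  have h5 := mul_le_mul_of_nonneg_right h2 hd
  nlinarith

lemma passageBound_le {lu δ d : ℝ} {N : ℕ} (hlu : 1 < lu) (hδ : 0 ≤ δ) (hd : 0 ≤ d)
    (hN : lu ^ N * d ≤ 272 / 100 * δ) {k : ℕ} (hk : k ≤ N) :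
    passageBound lu δ d k ≤ 4 * δ := by
  have hi : 0 < lu⁻¹ := inv_pos.2 (by linarith)
  have hμ0 : 0 ≤ 1 - 9 / 10 * (1 - lu⁻¹) := by linarith
  have hμ1 : 1 - 9 / 10 * (1 - lu⁻¹) ≤ 1 := by linarith [inv_lt_one_of_one_lt₀ hlu]
  have h1 : lu ^ k * d ≤ lu ^ N * d := by
    have := pow_le_pow_right₀ hlu.le hk; gcongr
  have h2 := mul_le_of_le_one_right hδ (pow_le_one₀ (n := k) hμ0 hμ1)
  unfold passageBound; linarith

lemma eta_sum_passageBound_le {lu δ d η L : ℝ} {N : ℕ} (hlu : 1 < lu) (hδ : 0 ≤ δ) (hd : 0 ≤ d)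
    (hN : lu ^ N * d ≤ 272 / 100 * δ) (hη : 0 ≤ η) (hL : L * (η * δ) ≤ 1 - lu⁻¹) (hL0 : 0 < L)
    {k : ℕ} (hk : k ≤ N + 1) :
    ∑ i ∈ Finset.range k, η * passageBound lu δ d i ≤ 5 / L := by
  have h := sum_passageBound_le hlu hδ hd hN hk
  have hθ : 0 < 1 - lu⁻¹ := by linarith [inv_lt_one_of_one_lt₀ hlu]
  rw [← Finset.mul_sum, le_div_iff₀ hL0]
  have h2 := mul_le_mul_of_nonneg_left h (mul_nonneg hη hL0.le)
  have h3 : (1 - lu⁻¹) * ((η * ∑ i ∈ Finset.range k, passageBound lu δ d i) * L) ≤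
      (1 - lu⁻¹) * 5 := by nlinarith
  exact le_of_mul_le_mul_left h3 hθ

lemma exp_le_of_le {x : ℝ} (hx : x ≤ 1 / 64) : Real.exp x ≤ 11 / 10 := by
  have h1 := Real.add_one_le_exp (-x)
  rw [Real.exp_neg] at h1
  have h2 := Real.exp_pos x
  have h3 : (-x + 1) * Real.exp x ≤ 1 := by
    calc _ ≤ (Real.exp x)⁻¹ * Real.exp x := by gcongr
      _ = 1 := inv_mul_cancel₀ h2.ne'
  nlinarith

/-- Passage near the saddle, as long as the distance from the local stable manifold is small. -/
lemma saddle_passage {Φ : ℝ × ℝ → ℝ × ℝ} {lu R η δ : ℝ} (hlu : 1 < lu) (hη0 : 0 ≤ η)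
    (hη : QuadraticBound (fun z => Φ z - saddleLin lu z) R η) (hδ : 0 ≤ δ) (hδR : 4 * δ ≤ R)
    (hηδ : 320 * (η * δ) ≤ 1 - lu⁻¹) {q s : ℝ × ℝ}
    (hs : ∀ k, ‖Φ^[k] s‖ ≤ δ * (1 - 9 / 10 * (1 - lu⁻¹)) ^ k) {N : ℕ}
    (hN : lu ^ N * ‖q - s‖ ≤ 272 / 100 * δ) :
    ∀ k ≤ N, ‖Φ^[k] q‖ ≤ passageBound lu δ ‖q - s‖ k := by
  set d := ‖q - s‖ with hd
  have hd0 : 0 ≤ d := norm_nonneg _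
  have h0 : 0 < lu := by linarith
  set b : ℕ → ℝ := fun i => η * passageBound lu δ d i with hb
  have hb0 : ∀ i, 0 ≤ b i := fun i => mul_nonneg hη0 (passageBound_nonneg hlu hδ hd0 i)
  -- Source of the factor `11 / 10` in `passageBound`; the sum is at most `5 / 320 = 1 / 64`.
  have hexp : ∀ k ≤ N, Real.exp (∑ i ∈ Finset.range k, b i) ≤ 11 / 10 := fun k hk =>
    exp_le_of_le ((eta_sum_passageBound_le hlu hδ hd0 hN hη0 hηδ (by norm_num)
      (hk.trans (Nat.le_succ _))).trans (by norm_num))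
  -- Bootstrap: the deviation at time `k` bounds the norm at time `k`, which controls the nonlinear
  -- error in the next step.
  have hq : ∀ k ≤ N, ‖Φ^[k] q - Φ^[k] s‖ ≤
      lu ^ k * d * Real.exp (∑ i ∈ Finset.range k, b i) →
      ‖Φ^[k] q‖ ≤ passageBound lu δ d k := by
    intro k hk h
    have h1 : lu ^ k * d * Real.exp (∑ i ∈ Finset.range k, b i) ≤ lu ^ k * d * (11 / 10) := by
      have := hexp k hk; gcongr
    have h2 := norm_le_norm_add_norm_sub' (Φ^[k] q) (Φ^[k] s)
    have := hs k
    unfold passageBound; linarith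
  have key : ∀ k ≤ N, ‖Φ^[k] q - Φ^[k] s‖ ≤
      lu ^ k * d * Real.exp (∑ i ∈ Finset.range k, b i) := by
    intro k
    induction k with
    | zero => intro _; simp [hd]
    | succ k ih =>
      intro hk
      have ih := ih (by omega)
      have hqk := hq k (by omega) ih
      have hpos : 0 ≤ 11 / 10 * (lu ^ k * d) := by positivity
      have hsk : ‖Φ^[k] s‖ ≤ passageBound lu δ d k := by
        have := hs k; unfold passageBound; linarith
      have hle := passageBound_le hlu hδ hd0 hN (show k ≤ N by omega)
      have h1 := hη.sub_le (Φ^[k] q) (by simp; linarith) (Φ^[k] s) (by simp; linarith)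
      have h2 : Φ^[k + 1] q - Φ^[k + 1] s = saddleLin lu (Φ^[k] q - Φ^[k] s) +
          ((Φ (Φ^[k] q) - saddleLin lu (Φ^[k] q)) - (Φ (Φ^[k] s) - saddleLin lu (Φ^[k] s))) := by
        rw [Function.iterate_succ_apply', Function.iterate_succ_apply', map_sub]; abel
      have hbk := hb0 k
      have hbk1 := Real.add_one_le_exp (b k)
      calc ‖Φ^[k + 1] q - Φ^[k + 1] s‖
          ≤ lu * ‖Φ^[k] q - Φ^[k] s‖ + b k * ‖Φ^[k] q - Φ^[k] s‖ := by
            rw [h2]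
            refine (norm_add_le _ _).trans (add_le_add (norm_saddleLin_le hlu _) (h1.trans ?_))
            have := max_le hqk hsk
            simp only [hb]; gcongr
        _ ≤ lu * Real.exp (b k) * ‖Φ^[k] q - Φ^[k] s‖ := by
            rw [← add_mul]
            gcongr
            nlinarith
        _ ≤ lu * Real.exp (b k) * (lu ^ k * d * Real.exp (∑ i ∈ Finset.range k, b i)) := by
            gcongr
        _ = _ := by rw [Finset.sum_range_succ, Real.exp_add]; ring
  exact fun k hk => hq k hk (key k hk)

/-- The tangent map along an orbit near the saddle is close to a power of the linear saddle. -/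
lemma IsAreaPreservingSaddle.tangent_passage {M : Set (ℝ × ℝ)} {Φ Ψ : ℝ × ℝ → ℝ × ℝ}
    {lu R η : ℝ} (h : IsAreaPreservingSaddle M Φ Ψ lu)
    (hη : QuadraticBound (fun z => Φ z - saddleLin lu z) R η) {q : ℝ × ℝ} {b : ℕ → ℝ} {N : ℕ}
    (hqM : q ∈ M) (hq : ∀ k < N, Φ^[k] q ∈ Metric.closedBall (0 : ℝ × ℝ) R)
    (hb : ∀ k < N, η * ‖Φ^[k] q‖ ≤ b k) (u : ℝ × ℝ) :
    ∀ k ≤ N, ‖fderiv ℝ (Φ^[k]) q u - (saddleLin lu ^ k) u‖ ≤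
      lu ^ k * ‖u‖ * (Real.exp (∑ i ∈ Finset.range k, b i) - 1) := by
  have hlu := h.one_lt
  have h0 : 0 < lu := by linarith
  intro k
  induction k with
  | zero => intro _; simp
  | succ k ih =>
    intro hk
    have ih := ih (by omega)
    set E := Real.exp (∑ i ∈ Finset.range k, b i)
    rw [h.fderiv_iterate_succ k hqM, Finset.sum_range_succ, Real.exp_add, pow_succ',
      mul_apply_eq_comp]
    set x := fderiv ℝ (Φ^[k]) q u
    set y := (saddleLin lu ^ k) u
    have hy : ‖y‖ ≤ lu ^ k * ‖u‖ := norm_saddleLin_pow_le hlu k u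
    have hx : ‖x‖ ≤ lu ^ k * ‖u‖ * E := by
      have := norm_le_norm_add_norm_sub' x y
      nlinarith
    have hdf : fderiv ℝ (fun z => Φ z - saddleLin lu z) (Φ^[k] q) =
        fderiv ℝ Φ (Φ^[k] q) - saddleLin lu := by
      rw [fderiv_fun_sub (h.differentiableAt (h.iterate_mem hqM k))
        (saddleLin lu).differentiableAt, ContinuousLinearMap.fderiv]
    have h1 := (hη.fderiv_le _ (hq k (by omega))).trans (hb k (by omega))
    rw [hdf] at h1
    have hbk : 0 ≤ b k := (norm_nonneg _).trans h1
    have h2 : fderiv ℝ Φ (Φ^[k] q) x - saddleLin lu y =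
        saddleLin lu (x - y) + (fderiv ℝ Φ (Φ^[k] q) - saddleLin lu) x := by
      simp
    have hE : 0 < E := Real.exp_pos _
    have hU : 0 ≤ lu ^ k * ‖u‖ := by positivity
    calc ‖fderiv ℝ Φ (Φ^[k] q) x - saddleLin lu y‖
        ≤ lu * (lu ^ k * ‖u‖ * (E - 1)) + b k * (lu ^ k * ‖u‖ * E) := by
          rw [h2]
          refine (norm_add_le _ _).trans (add_le_add ?_ ?_)
          · exact (norm_saddleLin_le hlu _).trans (by gcongr)
          · exact ((fderiv ℝ Φ (Φ^[k] q) - saddleLin lu).le_opNorm x).trans (by gcongr)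
      -- The error is enlarged by `lu ≥ 1` so that `lu` factors out and the errors multiply as `E *
      -- (1 + b k)`.
      _ ≤ lu * (lu ^ k * ‖u‖ * (E - 1)) + (lu * b k) * (lu ^ k * ‖u‖ * E) := by
          gcongr
          nlinarith
      _ = lu * (lu ^ k * ‖u‖) * (E * (b k + 1) - 1) := by ring
      _ ≤ lu * (lu ^ k * ‖u‖) * (E * Real.exp (b k) - 1) := by
          have := Real.add_one_le_exp (b k)
          gcongr
      _ = _ := by ring

/-! ### Closeness to the local unstable manifold. -/

/-- Under the inverse of the saddle map, vertical distances expand. -/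
lemma backward_vertical_expansion {Ψ : ℝ × ℝ → ℝ × ℝ} {lu R η : ℝ} (hlu : 1 < lu)
    (hη : QuadraticBound (fun z => Ψ z - saddleLin lu⁻¹ z) R η) (hη0 : 0 ≤ η)
    {x y : ℝ × ℝ} {N : ℕ}
    {b : ℕ → ℝ} (hx : ∀ k < N, Ψ^[k] x ∈ Metric.closedBall (0 : ℝ × ℝ) R)
    (hy : ∀ k < N, Ψ^[k] y ∈ Metric.closedBall (0 : ℝ × ℝ) R)
    (hb : ∀ k < N, η * max ‖Ψ^[k] x‖ ‖Ψ^[k] y‖ ≤ b k) (hb' : ∀ k < N, 2 * b k ≤ 1 - lu⁻¹)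
    (h1 : x.1 = y.1) :
    ∀ k ≤ N, |(Ψ^[k] x - Ψ^[k] y).1| ≤ |(Ψ^[k] x - Ψ^[k] y).2| ∧
      lu ^ k * (1 - ∑ i ∈ Finset.range k, b i) * |x.2 - y.2| ≤ |(Ψ^[k] x - Ψ^[k] y).2| := by
  have h0 : 0 < lu := by linarith
  have hi : 0 < lu⁻¹ := inv_pos.2 h0
  intro k
  induction k with
  | zero => intro _; simp [h1]
  | succ k ih =>
    intro hk
    obtain ⟨ih1, ih2⟩ := ih (by omega)
    have hbk := hb k (by omega)
    have hbk' := hb' k (by omega)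
    have hb0 : 0 ≤ b k := le_trans (by positivity) hbk
    have hsum : 0 ≤ ∑ i ∈ Finset.range k, b i := Finset.sum_nonneg fun i hi =>
      le_trans (by positivity) (hb i (by have := Finset.mem_range.1 hi; omega))
    have hf := hη.sub_le _ (hx k (by omega)) _ (hy k (by omega))
    rw [Function.iterate_succ_apply', Function.iterate_succ_apply']
    set X := Ψ^[k] x
    set Y := Ψ^[k] y
    have hn : ‖X - Y‖ = |(X - Y).2| := max_eq_right ih1
    have hf' : ‖(Ψ X - saddleLin lu⁻¹ X) - (Ψ Y - saddleLin lu⁻¹ Y)‖ ≤ b k * |(X - Y).2| := by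
      refine hf.trans ?_
      rw [hn]; gcongr
    have hf1 := (norm_fst_le _).trans hf'
    have hf2 := (norm_snd_le _).trans hf'
    simp only [Prod.fst_sub, Prod.snd_sub, saddleLin_apply, inv_inv, Real.norm_eq_abs]
      at hf1 hf2 ih1 ih2 ⊢
    have e1 : (Ψ X).1 - lu⁻¹ * X.1 - ((Ψ Y).1 - lu⁻¹ * Y.1) =
      ((Ψ X).1 - (Ψ Y).1) - lu⁻¹ * (X.1 - Y.1) := by ring
    have e2 : (Ψ X).2 - lu * X.2 - ((Ψ Y).2 - lu * Y.2) =
      ((Ψ X).2 - (Ψ Y).2) - lu * (X.2 - Y.2) := by ring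
    rw [e1] at hf1
    rw [e2, abs_sub_comm] at hf2
    have g1 := abs_sub_abs_le_abs_sub ((Ψ X).1 - (Ψ Y).1) (lu⁻¹ * (X.1 - Y.1))
    have g2 := abs_sub_abs_le_abs_sub (lu * (X.2 - Y.2)) ((Ψ X).2 - (Ψ Y).2)
    rw [abs_mul, abs_of_pos hi] at g1
    rw [abs_mul, abs_of_pos h0] at g2
    set p := |X.2 - Y.2|
    have hp : 0 ≤ p := abs_nonneg _
    have hp1 : lu⁻¹ * |X.1 - Y.1| ≤ lu⁻¹ * p := by gcongr
    have hlow : (lu - b k) * p ≤ |(Ψ X).2 - (Ψ Y).2| := by linarith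
    have hi1 : lu⁻¹ < 1 := inv_lt_one_of_one_lt₀ hlu
    constructor
    -- Invariance of the vertical cone, from `2 * b k ≤ 1 - lu⁻¹` and `lu ≥ 1`.
    · have : (lu⁻¹ + b k) * p ≤ (lu - b k) * p := by
        gcongr; linarith
      linarith
    · refine le_trans ?_ hlow
      have hL : lu * (1 - b k) ≤ lu - b k := by nlinarith
      have hb1 : 0 ≤ 1 - b k := by linarith
      calc lu ^ (k + 1) * (1 - ∑ i ∈ Finset.range (k + 1), b i) * |x.2 - y.2|
          ≤ lu ^ (k + 1) * ((1 - b k) * (1 - ∑ i ∈ Finset.range k, b i)) * |x.2 - y.2| := by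
            rw [Finset.sum_range_succ]
            gcongr
            nlinarith
        _ = lu * (1 - b k) *
            (lu ^ k * (1 - ∑ i ∈ Finset.range k, b i) * |x.2 - y.2|) := by ring
        _ ≤ lu * (1 - b k) * p := by gcongr
        _ ≤ (lu - b k) * p := by gcongr

/-- After a passage of length `N` near the saddle, an orbit is `O(lu ^ (-N))`-close to the local
unstable manifold. -/
lemma IsAreaPreservingSaddle.dist_projUnstable {M : Set (ℝ × ℝ)} {Φ Ψ : ℝ × ℝ → ℝ × ℝ}
    {lu R η δ r lw d : ℝ} {wu : ℝ → ℝ} (h : IsAreaPreservingSaddle M Φ Ψ lu)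
    (hη0 : 0 ≤ η) (hη_inv : QuadraticBound (fun z => Ψ z - saddleLin lu⁻¹ z) R η)
    (hrR : r ≤ R) (hWu : localStable Ψ r = {z | |z.1| ≤ r ∧ z.2 = wu z.1})
    (hwu : GraphBound wu r η lw) (hδ : 0 ≤ δ) (hδr : 4 * δ ≤ r)
    (hηδ : 320 * (η * δ) ≤ 1 - lu⁻¹) {q : ℝ × ℝ} (hqM : q ∈ M) (hq0 : ‖q‖ ≤ δ) {N : ℕ}
    (hd : 0 ≤ d) (hN : lu ^ N * d ≤ 272 / 100 * δ)
    (hq : ∀ k ≤ N, ‖Φ^[k] q‖ ≤ passageBound lu δ d k) :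
    lu ^ N * ‖Φ^[N] q - projUnstable wu (Φ^[N] q)‖ ≤ 6 * δ := by
  have hlu := h.one_lt
  have h0 : 0 < lu := by linarith
  have hi : 0 < lu⁻¹ := inv_pos.2 h0
  have hi1 : lu⁻¹ < 1 := inv_lt_one_of_one_lt₀ hlu
  have hμ0 : 0 ≤ 1 - 9 / 10 * (1 - lu⁻¹) := by linarith
  have hμ1 : 1 - 9 / 10 * (1 - lu⁻¹) ≤ 1 := by linarith
  set Q := Φ^[N] q with hQ
  set ζ := projUnstable wu Q with hζ
  have hle : ∀ k ≤ N, ‖Φ^[k] q‖ ≤ 4 * δ := fun k hk =>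
    (hq k hk).trans (passageBound_le hlu hδ hd hN hk)
  have hQ1 : |Q.1| ≤ 4 * δ := (norm_fst_le Q).trans (hle N le_rfl)
  have hζW : ζ ∈ localStable Ψ r := by
    rw [hWu]; exact ⟨hQ1.trans hδr, rfl⟩
  have hζk := localUnstable_decay hlu hη0 hη_inv hrR hWu hwu (D := 4 * δ) (by linarith) hζW hQ1
  have hζk' : ∀ k, ‖Ψ^[k] ζ‖ ≤ 4 * δ := fun k =>
    (hζk k).trans (mul_le_of_le_one_right (by linarith) (pow_le_one₀ hμ0 hμ1))
  have hback := h.inv_iterate_iterate hqM N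
  -- The maximum of the two norms is replaced by their sum. The backward orbit of `Q` retraces that
  -- of `q`, hence the index `N - k`.
  set b : ℕ → ℝ := fun k =>
    η * passageBound lu δ d (N - k) + η * (4 * δ * (1 - 9 / 10 * (1 - lu⁻¹)) ^ k) with hb
  have hpb : ∀ k, 0 ≤ passageBound lu δ d k := passageBound_nonneg hlu hδ hd
  have key := backward_vertical_expansion hlu hη_inv hη0 (x := Q) (y := ζ) (N := N) (b := b)
    (fun k hk => by rw [hback k hk.le]; have := hle (N - k) (by omega); simp; linarith)
    (fun k _ => by have := hζk' k; simp; linarith)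
    (fun k hk => by
      rw [hback k hk.le]
      simp only [hb, ← mul_add]
      have h1 := hq (N - k) (by omega)
      have h2 := hζk k
      have h3 := (norm_nonneg _).trans h2
      have h4 := hpb (N - k)
      gcongr
      exact max_le (by linarith) (by linarith))
    (fun k hk => by
      simp only [hb, ← mul_add]
      have h1 := passageBound_le hlu hδ hd hN (show N - k ≤ N by omega)
      have h2 : 4 * δ * (1 - 9 / 10 * (1 - lu⁻¹)) ^ k ≤ 4 * δ :=
        mul_le_of_le_one_right (by linarith) (pow_le_one₀ hμ0 hμ1)
      have h3 : η * (passageBound lu δ d (N - k) + 4 * δ * (1 - 9 / 10 * (1 - lu⁻¹)) ^ k) ≤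
        η * (8 * δ) := by gcongr; linarith
      linarith) rfl N le_rfl
  have hsum : ∑ i ∈ Finset.range N, b i ≤ 1 / 10 := by
    have s1 : ∑ i ∈ Finset.range N, η * passageBound lu δ d (N - i) ≤ 5 / 320 := by
      refine le_trans ?_ (eta_sum_passageBound_le hlu hδ hd hN hη0 hηδ (by norm_num) le_rfl)
      rw [← Finset.sum_range_reflect (fun i => η * passageBound lu δ d i) (N + 1),
        Finset.sum_range_succ]
      simp only [Nat.add_sub_cancel]
      have := mul_nonneg hη0 (hpb (N - N))
      linarith
    have s2 : ∑ i ∈ Finset.range N, η * (4 * δ * (1 - 9 / 10 * (1 - lu⁻¹)) ^ i) ≤ 5 / 320 := by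
      simp only [← Finset.mul_sum]
      have g := sum_geom_contraction_le hlu N
      set S := ∑ i ∈ Finset.range N, (1 - 9 / 10 * (1 - lu⁻¹)) ^ i
      have hS : 0 ≤ S := Finset.sum_nonneg fun i _ => pow_nonneg hμ0 i
      nlinarith [mul_le_mul_of_nonneg_right hηδ hS]
    simp only [hb, Finset.sum_add_distrib]
    linarith
  have hnorm : ‖Q - ζ‖ = |Q.2 - ζ.2| := by
    have : (Q - ζ).1 = 0 := sub_self _
    rw [Prod.norm_def, this]; simp
  have hsub : ‖Ψ^[N] Q - Ψ^[N] ζ‖ ≤ ‖Ψ^[N] Q‖ + ‖Ψ^[N] ζ‖ := _root_.norm_sub_le _ _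
  -- After `N` backward steps `Q` is back at `q`, of norm at most `δ`, and `ζ` has stayed within `4
  -- δ`.
  have hup : |(Ψ^[N] Q - Ψ^[N] ζ).2| ≤ 5 * δ := by
    refine (norm_snd_le _).trans (hsub.trans ?_)
    have := hζk' N
    rw [hback N le_rfl]
    simp only [Nat.sub_self, Function.iterate_zero, id]
    linarith
  have hfin : lu ^ N * (9 / 10) * |Q.2 - ζ.2| ≤ 5 * δ := by
    refine le_trans ?_ (key.2.trans hup)
    gcongr
    linarith
  rw [hnorm]
  linarith

/-! ### Escape times, numerical constants, and the resulting tangent estimates. -/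

lemma pow_mul_le_of_le_escapeTime {lu δ d : ℝ} (hlu : 1 < lu) (hδ : 0 < δ) (hd : 0 ≤ d) {n : ℕ}
    (h : ((n : ℤ) : WithTop ℤ) ≤ escapeTime lu δ d) : lu ^ n * d ≤ Real.exp 1 * δ := by
  rcases hd.eq_or_lt with rfl | hd
  · rw [mul_zero]; positivity
  rw [escapeTime, if_neg hd.ne', WithTop.coe_le_coe, Int.le_floor, le_div_iff₀ (Real.log_pos hlu),
    Int.cast_natCast, ← Real.log_pow, Real.log_le_log_iff (by positivity) (by positivity),
    le_div_iff₀ hd] at h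
  exact h

lemma exp_one_le : Real.exp 1 ≤ 272 / 100 := by
  linarith [Real.exp_one_lt_d9]

/-- The numerical consequences of the smallness assumption on `δ₀`. -/
lemma smallness_bound {lu η δ₀ δ T : ℝ} (hlu : 1 < lu) (hT : 0 < T) (hδ₀ : 0 < δ₀)
    (hδ : δ = δ₀ / T)
    (h : δ₀ ≤ 1 / (16 * (max 1 η) ^ 2 * Real.exp 1 ^ 3 * lu ^ 2) * (1 - 1 / lu)) :
    320 * T * (η * δ) ≤ 1 - lu⁻¹ ∧ 320 * T * δ ≤ 1 - lu⁻¹ := by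
  -- The constant `320` is `16 * 20`.
  have he : (20 : ℝ) ≤ Real.exp 1 ^ 3 := by
    calc (20 : ℝ) ≤ 2.7182 ^ 3 := by norm_num
      _ ≤ Real.exp 1 ^ 3 := by
        have := Real.exp_one_gt_d9
        gcongr; linarith
  set m := max 1 η
  have hm1 : 1 ≤ m := le_max_left _ _
  have hmη : η ≤ m := le_max_right _ _
  rw [one_div_mul_eq_div, le_div_iff₀ (by positivity), one_div] at h
  have hlu2 : 1 ≤ lu ^ 2 := one_le_pow₀ hlu.le
  have h1 : δ₀ * (320 * m) ≤ δ₀ * (16 * m ^ 2 * Real.exp 1 ^ 3 * lu ^ 2) := by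
    refine mul_le_mul_of_nonneg_left ?_ hδ₀.le
    calc 320 * m = 16 * m * 20 * 1 := by ring
      _ ≤ 16 * m ^ 2 * Real.exp 1 ^ 3 * lu ^ 2 := by
        gcongr
        nlinarith
  have e : T * δ = δ₀ := by rw [hδ]; field_simp
  have h2 : 320 * T * (η * δ) = δ₀ * (320 * η) := by rw [← e]; ring
  have h3 : 320 * T * δ = δ₀ * (320 * 1) := by rw [← e]; ring
  rw [h2, h3]
  constructor
  · refine le_trans ?_ (h1.trans h); gcongr
  · refine le_trans ?_ (h1.trans h); gcongr

/-- The tangent map along an orbit which starts near the local stable manifold and stays near the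
saddle for `N` iterations. -/
lemma IsAreaPreservingSaddle.tangent_near_saddle {M : Set (ℝ × ℝ)} {Φ Ψ : ℝ × ℝ → ℝ × ℝ}
    {lu R η δ r lw T : ℝ} {ws : ℝ → ℝ} (h : IsAreaPreservingSaddle M Φ Ψ lu)
    (hRM : Metric.closedBall (0 : ℝ × ℝ) R ⊆ M) (hη0 : 0 ≤ η)
    (hη : QuadraticBound (fun z => Φ z - saddleLin lu z) R η) (hrR : r ≤ R)
    (hWs : localStable Φ r = {z | |z.2| ≤ r ∧ z.1 = ws z.2}) (hws : GraphBound ws r η lw)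
    (hT : 1 ≤ T) (hδ : 0 ≤ δ) (hδr : 4 * δ ≤ r) (hηδ : 320 * T * (η * δ) ≤ 1 - lu⁻¹)
    (hδT : 320 * T * δ ≤ 1 - lu⁻¹) {q : ℝ × ℝ} (hq : ‖q‖ ≤ δ) {N : ℕ}
    (hN : lu ^ N * stableDist ws q ≤ 272 / 100 * δ) {u w : ℝ × ℝ} (hw : ‖w‖ = |w.1|)
    (hu : ‖u - w‖ ≤ δ * |w.1|) :
    (∀ k ≤ N, ‖Φ^[k] q‖ ≤ passageBound lu δ (stableDist ws q) k) ∧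
      ‖fderiv ℝ (Φ^[N]) q u - (saddleLin lu ^ N) w‖ ≤ lu ^ N * |w.1| * (1 / (15 * T)) := by
  have hlu := h.one_lt
  have h0 : 0 < lu := by linarith
  have hi : 0 < lu⁻¹ := inv_pos.2 h0
  have hqR : q ∈ Metric.closedBall (0 : ℝ × ℝ) R := by simp; linarith
  have hηδ0 : 0 ≤ η * δ := mul_nonneg hη0 hδ
  have hηδ1 : 320 * (η * δ) ≤ 1 - lu⁻¹ := by nlinarith
  set s : ℝ × ℝ := (ws q.2, q.2) with hs
  have hq2 : |q.2| ≤ δ := (norm_snd_le q).trans hq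
  have hsW : s ∈ localStable Φ r := by rw [hWs]; exact ⟨by simp only [hs]; linarith, rfl⟩
  have hdist : ‖q - s‖ = stableDist ws q := by
    simp [hs, stableDist, Prod.norm_def]
  have hpass := saddle_passage hlu hη0 hη hδ (by linarith) hηδ1
    (localStable_decay hlu hη0 hη hrR hWs hws (by linarith) hsW hq2) (N := N) (q := q)
    (by rwa [hdist])
  rw [hdist] at hpass
  refine ⟨hpass, ?_⟩
  have hd : 0 ≤ stableDist ws q := abs_nonneg _
  have ht := h.tangent_passage hη (hRM hqR) (N := N)
    (b := fun i => η * passageBound lu δ (stableDist ws q) i)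
    (fun k hk => by
      have := (hpass k hk.le).trans (passageBound_le hlu hδ hd hN hk.le)
      simp; linarith)
    (fun k hk => mul_le_mul_of_nonneg_left (hpass k hk.le) hη0) u N le_rfl
  have hS := eta_sum_passageBound_le hlu hδ hd hN hη0 hηδ (by positivity) (Nat.le_succ N)
  set S := ∑ i ∈ Finset.range N, η * passageBound lu δ (stableDist ws q) i
  have hτ : 5 / (320 * T) = 1 / (64 * T) := by field_simp; norm_num
  rw [hτ] at hS
  have hτ1 : 1 / (64 * T) ≤ 1 / 64 := by gcongr; linarith
  have hS0 : 0 ≤ S := Finset.sum_nonneg fun i _ =>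
    mul_nonneg hη0 (passageBound_nonneg hlu hδ hd i)
  -- From `exp S - 1 ≤ S * exp S` and `exp S ≤ 11 / 10`.
  have hexp : Real.exp S - 1 ≤ 2 * (1 / (64 * T)) := by
    have h1 := Real.add_one_le_exp (-S)
    have h2 := exp_le_of_le (hS.trans hτ1)
    have h3 : Real.exp (-S) * Real.exp S = 1 := by rw [← Real.exp_add]; simp
    nlinarith [Real.exp_pos S]
  have hδ1 : δ ≤ 1 / (320 * T) := by
    rw [le_div_iff₀ (by positivity)]; linarith
  have hδ2 : δ ≤ 1 / 320 := hδ1.trans (by gcongr; linarith)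
  have hun : ‖u‖ ≤ 2 * |w.1| := by
    have := norm_le_norm_add_norm_sub' u w
    nlinarith [abs_nonneg w.1]
  have e1 : fderiv ℝ (Φ^[N]) q u - (saddleLin lu ^ N) w =
      (fderiv ℝ (Φ^[N]) q u - (saddleLin lu ^ N) u) + (saddleLin lu ^ N) (u - w) := by
    rw [map_sub]; abel
  have hE0 : 0 ≤ Real.exp S - 1 := by linarith [Real.add_one_le_exp S]
  calc ‖fderiv ℝ (Φ^[N]) q u - (saddleLin lu ^ N) w‖
      ≤ lu ^ N * (2 * |w.1|) * (2 * (1 / (64 * T))) + lu ^ N * (1 / (320 * T) * |w.1|) := by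
        rw [e1]
        refine (norm_add_le _ _).trans (add_le_add (ht.trans ?_)
          ((norm_saddleLin_pow_le hlu N _).trans ?_))
        · gcongr
        · have := hu.trans (mul_le_mul_of_nonneg_right hδ1 (abs_nonneg w.1))
          gcongr
    _ = lu ^ N * |w.1| * ((21 / 320) * (1 / T)) := by field_simp; ring
    _ ≤ lu ^ N * |w.1| * (1 / 15 * (1 / T)) :=
        mul_le_mul_of_nonneg_left (mul_le_mul_of_nonneg_right (by norm_num) (by positivity))
          (by positivity)
    _ = lu ^ N * |w.1| * (1 / (15 * T)) := by rw [one_div_mul_one_div]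

lemma GraphBound.const_nonneg {g : ℝ → ℝ} {r η lw : ℝ} (h : GraphBound g r η lw) (hr : 0 < r) :
    0 ≤ lw := by
  have h2 := h.sub_le r ⟨by linarith, le_rfl⟩ 0 ⟨by linarith, hr.le⟩
  simp only [abs_zero, sub_zero, abs_of_pos hr, max_eq_left hr.le, mul_assoc] at h2
  exact nonneg_of_mul_nonneg_left ((abs_nonneg _).trans h2) (mul_pos hr hr)

lemma GraphBound.continuousOn {g : ℝ → ℝ} {r η lw : ℝ} (h : GraphBound g r η lw) (hr : 0 < r) :
    ContinuousOn g (Icc (-r) r) := by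
  have hlw := h.const_nonneg hr
  have hL : LipschitzOnWith (lw * r).toNNReal g (Icc (-r) r) := by
    refine LipschitzOnWith.of_dist_le' fun x hx y hy => ?_
    rw [Real.dist_eq, Real.dist_eq]
    refine (h.sub_le x hx y hy).trans ?_
    have := max_le (_root_.abs_le.2 hx) (_root_.abs_le.2 hy)
    gcongr
  exact hL.continuousOn

lemma passage_ratio_le {T X Y L : ℝ} (hT : 3 ≤ T) (hX : 0 ≤ X) (hY : 0 ≤ Y) (hL : 0 < L) :
    (1 + 6 * (1 / (320 * T))) * (X * (Y * (1 + 1 / (15 * T)))) ≤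
      (1 + 1 / T) * (X / L) * (Y * L * (1 - 1 / (15 * T))) := by
  set t := 1 / T with ht
  have ht0 : 0 < t := by positivity
  have ht3 : t ≤ 1 / 3 := by rw [ht]; gcongr
  have e1 : 1 / (320 * T) = t / 320 := by rw [ht]; field_simp
  have e2 : 1 / (15 * T) = t / 15 := by rw [ht]; field_simp
  rw [e1, e2]
  calc (1 + 6 * (t / 320)) * (X * (Y * (1 + t / 15)))
      = X * Y * ((1 + 6 * (t / 320)) * (1 + t / 15)) := by ring
    _ ≤ X * Y * ((1 + t) * (1 - t / 15)) :=
      mul_le_mul_of_nonneg_left (by nlinarith) (mul_nonneg hX hY)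
    _ = (1 + t) * (X / L) * (Y * L * (1 - t / 15)) := by field_simp

/-- In logarithms, `α n ≤ N` is exactly `(n - N) ln lam ≤ N ln lu`. -/
lemma pow_escape_le {lam lu α n : ℝ} (hlam : 1 < lam) (hlu : 1 < lu)
    (hα : α = Real.log lam / (Real.log lam + Real.log lu)) {j N : ℕ} (hN : α * n ≤ N)
    (hj : (j : ℝ) = n - N) : lam ^ j ≤ lu ^ N := by
  have h1 := Real.log_pos hlam
  have h2 := Real.log_pos hlu
  rw [← Real.log_le_log_iff (by positivity) (by positivity), Real.log_pow, Real.log_pow, hj]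
  rw [hα, div_mul_eq_mul_div, div_le_iff₀ (by positivity)] at hN
  linarith

/-! ### The proposition. -/

set_option maxHeartbeats 1000000 in
theorem proposition1
    -- the map
    (M : Set (ℝ × ℝ)) (Φ Ψ : ℝ × ℝ → ℝ × ℝ) (lu : ℝ)
    (hΦ : IsAreaPreservingSaddle M Φ Ψ lu)
    -- the ball on which the constants are defined, and the constant `η`
    (R η : ℝ) (hR : 0 < R) (hRM : Metric.closedBall (0 : ℝ × ℝ) R ⊆ M)
    (hη : QuadraticBound (fun z => Φ z - saddleLin lu z) R η)
    (hη_inv : QuadraticBound (fun z => Ψ z - saddleLin lu⁻¹ z) R η)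
    -- the constants `σ`, `λ`, `α`
    (σ lam α : ℝ) (hσ : σ = sigmaMin Φ R) (hlam : lam = lambdaConst Φ R)
    (hα : α = Real.log lam / (Real.log lam + Real.log lu))
    -- the local stable and unstable manifolds as graphs
    (r lw : ℝ) (ws wu : ℝ → ℝ) (hr : 0 < r) (hrR : r ≤ R)
    (hWs : localStable Φ r = {z | |z.2| ≤ r ∧ z.1 = ws z.2})
    (hWu : localStable Ψ r = {z | |z.1| ≤ r ∧ z.2 = wu z.1})
    (hws : GraphBound ws r η lw) (hwu : GraphBound wu r η lw)
    -- the time `T` and the size `δ`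
    (T : ℕ) (δ₀ δ : ℝ) (hδ₀ : 0 < δ₀)
    (hδ₀_le : δ₀ ≤ min (1 / (16 * (max 1 η) ^ 2 * Real.exp 1 ^ 3 * lu ^ 2) * (1 - 1 / lu)) (r / 2))
    (hδ : δ = δ₀ / T)
    -- the point `z_s`, the time `T_s`, the tangent vectors `v` and `w`
    (zs : ℝ × ℝ) (hzs : zs ∈ stableManifold M Φ)
    (Ts : ℕ) (hTs : Ts = entryTime Φ zs (δ - 2 * δ ^ 2))
    (hzs_loc : Φ^[Ts] zs ∈ localStable Φ r)
    (hzsR : ∀ k ≤ Ts, Φ^[k] zs ∈ Metric.closedBall (0 : ℝ × ℝ) R)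
    (v w : ℝ × ℝ) (hv : v ≠ 0) (hw : w = fderiv ℝ (Φ^[Ts]) zs v)
    (hw_dir : ‖((0 : ℝ), w.2)‖ ≤ ‖(w.1, (0 : ℝ))‖)
    -- the curve `z_ε`, the distance `Δ_ε`, the constant `ε₁`
    (z : ℝ → ℝ × ℝ) (ε₁ : ℝ) (hε₁ : 0 < ε₁)
    (hz_cont : ContinuousOn z (Icc 0 ε₁)) (hzM : ∀ ε ∈ Icc 0 ε₁, z ε ∈ M)
    (hz_zero : z 0 = zs) (hz_dist : ∀ ε ∈ Icc 0 ε₁, ‖zs - z ε‖ = ε)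
    (hz_dom : ∀ ε ∈ Icc 0 ε₁, |(Φ^[Ts] (z ε)).2| ≤ r)
    (Δ : ℝ → ℝ) (hΔ : ∀ ε, Δ ε = stableDist ws (Φ^[Ts] (z ε)))
    (hΔ_mono : StrictMonoOn Δ (Icc 0 ε₁))
    -- the three conditions on `T`
    (hT1 : Real.exp 1 * δ * lu ^ (-(α * ((T : ℝ) - Ts))) ≤ Δ ε₁)
    (hT2 : Real.exp 1 * lu ^ (-(α * ((T : ℝ) - Ts))) ≤
      σ ^ Ts * δ₀ / (max 1 η * (1 + lw) * lam ^ Ts * (T : ℝ) ^ 2))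
    (hT3 : (T : ℝ) > Ts + 1 / (1 - α)) :
    ∃ ε₀ ∈ Icc 0 ε₁, Δ ε₀ = Real.exp 1 * δ * lu ^ (-(α * ((T : ℝ) - Ts))) ∧
      ∀ ε ∈ Icc 0 ε₀, lam ^ Ts * ε < δ ^ 2 →
        (∀ k ≤ Ts, Φ^[k] (z ε) ∈ Metric.closedBall (0 : ℝ × ℝ) R) →
        -- (i)
        ((((T : ℤ) - (Ts : ℤ) : ℤ) : WithTop ℤ) ≤ escapeTime lu δ (Δ ε) →
          ‖fderiv ℝ (Φ^[T]) (z ε) v - (saddleLin lu ^ (T - Ts)) w‖ ≤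
            lu ^ (T - Ts) * (‖(w.1, (0 : ℝ))‖ / T)) ∧
        -- (ii), with `Te` the value of `T_ε`
        (∀ Te j : ℕ, escapeTime lu δ (Δ ε) = ((Te : ℤ) : WithTop ℤ) →
          α * ((T : ℝ) - Ts) ≤ Te → Te < T - Ts → j = T - Ts - Te →
          ∀ ζ : ℝ × ℝ, ζ = projUnstable wu (Φ^[Ts + Te] (z ε)) →
          (∀ k ≤ j, Φ^[k] (Φ^[Ts + Te] (z ε)) ∈ Metric.closedBall (0 : ℝ × ℝ) R) →
          (∀ k ≤ j, Φ^[k] ζ ∈ Metric.closedBall (0 : ℝ × ℝ) R) →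
          ‖fderiv ℝ (Φ^[T]) (z ε) v‖ / ‖fderiv ℝ (Φ^[T]) zs v‖ ≤
            (1 + 1 / (T : ℝ)) * (‖fderiv ℝ (Φ^[j]) ζ‖ / lu ^ j)) := by
  have hlu := hΦ.one_lt
  have h0 : 0 < lu := by linarith
  have hη0 := hη.eta_nonneg hR.le
  have hlamlu : lu ≤ lam := by rw [hlam]; exact hΦ.le_lambdaConst hR hRM
  have hlam1 : 1 < lam := by linarith
  have hlam0 : 0 ≤ lam := by linarith
  have hll : 0 < Real.log lu := Real.log_pos hlu
  have hlll : Real.log lu ≤ Real.log lam := Real.log_le_log h0 hlamlu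
  -- `lu ≤ lam` gives `α ≥ 1/2`, so `1 / (1 - α) ≥ 2`.
  have hT3' : (2 : ℝ) + Ts < T := by
    have h1 : 1 - α = Real.log lu / (Real.log lam + Real.log lu) := by
      rw [hα, one_sub_div (by linarith)]; ring
    have h2 : 2 ≤ 1 / (1 - α) := by
      rw [h1, one_div_div, le_div_iff₀ hll]; linarith
    linarith
  have hTN : 3 + Ts ≤ T := by
    have : 2 + Ts < T := by exact_mod_cast hT3'
    omega
  have hT3r : (3 : ℝ) ≤ T := by exact_mod_cast (show 3 ≤ T by omega)
  have hTpos : (0 : ℝ) < T := by linarith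
  have hδpos : 0 < δ := by rw [hδ]; positivity
  have hTδ : T * δ = δ₀ := by rw [hδ]; field_simp
  have hδr : 4 * δ ≤ r := by
    have := hδ₀_le.trans (min_le_right _ _)
    nlinarith
  obtain ⟨hηδ, hδT⟩ := smallness_bound hlu hTpos hδ₀ hδ (hδ₀_le.trans (min_le_left _ _))
  have hi : 0 < lu⁻¹ := inv_pos.2 h0
  have hδ1 : δ ≤ 1 / (320 * T) := by
    rw [le_div_iff₀ (by positivity)]; linarith
  have hδ2 : δ ≤ 1 / 320 := hδ1.trans (by gcongr; linarith)
  have hηδ1 : 320 * (η * δ) ≤ 1 - lu⁻¹ := by nlinarith [mul_nonneg hη0 hδpos.le]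
  -- the orbit of `z_s` enters the small ball
  set p := Φ^[Ts] zs with hp
  have hpball : ‖p‖ ≤ δ - 2 * δ ^ 2 := by
    have hpos : 0 < δ - 2 * δ ^ 2 := by nlinarith
    -- Convergence to the origin makes `entryTime` a genuine minimum instead of the default value
    -- `0`.
    have hne : {k : ℕ | Φ^[k] zs ∈ Metric.closedBall (0 : ℝ × ℝ) (δ - 2 * δ ^ 2)}.Nonempty :=
      (hzs.2.eventually (Metric.closedBall_mem_nhds _ hpos)).exists
    have := Nat.sInf_mem hne
    rw [Set.mem_ofPred_eq] at this
    rw [hp, hTs]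
    simpa [entryTime] using this
  have hpW : |p.2| ≤ r ∧ p.1 = ws p.2 := by rw [hWs] at hzs_loc; exact hzs_loc
  have hpd : stableDist ws p = 0 := by simp [stableDist, hpW.2]
  have hw1 : ‖(w.1, (0 : ℝ))‖ = |w.1| := by simp [Prod.norm_def]
  have hwn : ‖w‖ = |w.1| := by
    rw [hw1] at hw_dir
    have : |w.2| ≤ |w.1| := by simpa [Prod.norm_def] using hw_dir
    exact max_eq_left this
  have hA : ∀ N : ℕ, ‖(saddleLin lu ^ N) w‖ = lu ^ N * |w.1| := fun N => by
    refine le_antisymm ((norm_saddleLin_pow_le hlu N w).trans_eq (by rw [hwn])) ?_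
    refine le_trans (le_of_eq ?_) (norm_fst_le _)
    rw [saddleLin_pow_apply, Real.norm_eq_abs, abs_mul, abs_of_pos (pow_pos h0 N)]
  -- the intermediate value theorem
  have hws_cont : ContinuousOn ws (Icc (-r) r) := hws.continuousOn hr
  have hqc : ContinuousOn (fun ε => Φ^[Ts] (z ε)) (Icc 0 ε₁) := fun ε hε =>
    (hΦ.iterate_differentiableAt Ts (hzM ε hε)).continuousAt.comp_continuousWithinAt
      (hz_cont ε hε)
  have hΔc : ContinuousOn Δ (Icc 0 ε₁) := by
    have : Δ = fun ε => |(Φ^[Ts] (z ε)).1 - ws (Φ^[Ts] (z ε)).2| := funext hΔ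
    rw [this]
    exact ((continuous_fst.comp_continuousOn hqc).sub (hws_cont.comp
      (continuous_snd.comp_continuousOn hqc) fun ε hε => abs_le.1 (hz_dom ε hε))).abs
  have hΔ0 : Δ 0 = 0 := by rw [hΔ, hz_zero]; exact hpd
  obtain ⟨ε₀, hε₀, hΔε₀⟩ := intermediate_value_Icc hε₁.le hΔc
    (show Real.exp 1 * δ * lu ^ (-(α * ((T : ℝ) - Ts))) ∈ Icc (Δ 0) (Δ ε₁) from
      ⟨by rw [hΔ0]; positivity, hT1⟩)
  refine ⟨ε₀, hε₀, hΔε₀, fun ε hε hsmall horb => ?_⟩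
  have hεmem : ε ∈ Icc 0 ε₁ := ⟨hε.1, hε.2.trans hε₀.2⟩
  have hzεM := hzM ε hεmem
  -- closeness at the time `Ts`
  obtain ⟨hsh1, hsh2⟩ := hΦ.orbit_shadowing hR hRM horb hzsR v Ts le_rfl
  rw [← hlam, norm_sub_rev (z ε), hz_dist ε hεmem] at hsh1 hsh2
  rw [← hw, hwn] at hsh2
  set q := Φ^[Ts] (z ε) with hq
  set u := fderiv ℝ (Φ^[Ts]) (z ε) v with hu
  have hqM : q ∈ M := hΦ.iterate_mem hzεM Ts
  -- The radius `δ - 2 δ ^ 2` leaves room for the shadowing error, which is below `δ ^ 2`.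
  have hqn : ‖q‖ ≤ δ := by
    have := norm_le_norm_add_norm_sub' q p
    nlinarith
  have huw : ‖u - w‖ ≤ δ * |w.1| := by
    refine hsh2.trans ?_
    gcongr
    nlinarith
  have hΔε : Δ ε = stableDist ws q := hΔ ε
  have hd : 0 ≤ stableDist ws q := abs_nonneg _
  have hsplit : ∀ N, fderiv ℝ (Φ^[Ts + N]) (z ε) v = fderiv ℝ (Φ^[N]) q u := fun N =>
    hΦ.fderiv_iterate_add Ts N hzεM v
  have hpassN : ∀ N : ℕ, ((N : ℤ) : WithTop ℤ) ≤ escapeTime lu δ (Δ ε) →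
      lu ^ N * stableDist ws q ≤ 272 / 100 * δ := fun N hN => by
    rw [hΔε] at hN
    refine (pow_mul_le_of_le_escapeTime hlu hδpos hd hN).trans ?_
    have := exp_one_le
    gcongr
  have near := fun N hN => hΦ.tangent_near_saddle hRM hη0 hη hrR hWs hws (T := T) (by linarith)
    hδpos.le hδr hηδ hδT hqn (N := N) hN hwn huw
  constructor
  · intro hesc
    have e : (T : ℤ) - Ts = ((T - Ts : ℕ) : ℤ) := by omega
    rw [e] at hesc
    have h1 := (near (T - Ts) (hpassN _ hesc)).2
    rw [← hsplit, show Ts + (T - Ts) = T by omega] at h1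
    rw [hw1]
    refine h1.trans ?_
    rw [mul_assoc, div_eq_mul_one_div |w.1|]
    gcongr
    linarith
  · intro Te j hTe hαTe hTelt hj ζ hζ hQorb hζorb
    obtain ⟨hpass, hnum⟩ := near Te (hpassN _ hTe.ge)
    -- The point `p` lies on the stable manifold, so its distance is `0` and a passage of any length
    -- is admissible.
    have hden := (hΦ.tangent_near_saddle hRM hη0 hη hrR hWs hws (T := T) (q := p) (u := w) (w := w)
      (N := T - Ts) (by linarith) hδpos.le hδr hηδ hδT (by nlinarith)
      (by rw [hpd, mul_zero]; positivity) hwn (by rw [sub_self, norm_zero]; positivity)).2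
    have hdist := hΦ.dist_projUnstable hη0 hη_inv hrR hWu hwu hδpos.le hδr hηδ1 hqM hqn hd
      (hpassN _ hTe.ge) hpass
    have hQ : Φ^[Ts + Te] (z ε) = Φ^[Te] q := by
      rw [add_comm, Function.iterate_add_apply]
    rw [hQ] at hζ hQorb
    rw [← hζ] at hdist
    set Q := Φ^[Te] q with hQdef
    set y := fderiv ℝ (Φ^[Te]) q u with hy
    have hDT : fderiv ℝ (Φ^[T]) (z ε) v = fderiv ℝ (Φ^[j]) Q y := by
      rw [← hΦ.fderiv_iterate_add Te j hqM u, show Te + j = T - Ts by omega, ← hsplit,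
        show Ts + (T - Ts) = T by omega]
    have hDTs : fderiv ℝ (Φ^[T]) zs v = fderiv ℝ (Φ^[T - Ts]) p w := by
      rw [hw, ← hΦ.fderiv_iterate_add Ts (T - Ts) hzs.1 v, show Ts + (T - Ts) = T by omega]
    have hsh := ((hΦ.orbit_shadowing hR hRM hQorb hζorb y) j le_rfl).2
    rw [← hlam] at hsh
    have hjr : (j : ℝ) = ((T : ℝ) - Ts) - Te := by
      rw [hj, Nat.cast_sub hTelt.le, Nat.cast_sub (by omega)]
    have hrel : lam ^ j * ‖Q - ζ‖ ≤ 6 * δ := by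
      refine le_trans ?_ hdist
      have := pow_escape_le hlam1 hlu hα hαTe hjr
      gcongr
    have hyn : ‖y‖ ≤ lu ^ Te * |w.1| * (1 + 1 / (15 * T)) := by
      have := norm_le_norm_add_norm_sub' y ((saddleLin lu ^ Te) w)
      rw [hA] at this
      linarith
    have hnumb : ‖fderiv ℝ (Φ^[T]) (z ε) v‖ ≤ (1 + 6 * (1 / (320 * T))) *
        (‖fderiv ℝ (Φ^[j]) ζ‖ * (lu ^ Te * |w.1| * (1 + 1 / (15 * T)))) := by
      rw [hDT]
      have h1 := norm_le_norm_add_norm_sub' (fderiv ℝ (Φ^[j]) Q y) (fderiv ℝ (Φ^[j]) ζ y)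
      have h2 := mul_le_mul_of_nonneg_right hrel (norm_nonneg (fderiv ℝ (Φ^[j]) ζ y))
      calc ‖fderiv ℝ (Φ^[j]) Q y‖ ≤ (1 + 6 * δ) * ‖fderiv ℝ (Φ^[j]) ζ y‖ := by linarith
        _ ≤ _ := by
          gcongr
          exact ((fderiv ℝ (Φ^[j]) ζ).le_opNorm y).trans (by gcongr)
    have hdenb : lu ^ (T - Ts) * |w.1| * (1 - 1 / (15 * T)) ≤ ‖fderiv ℝ (Φ^[T]) zs v‖ := by
      rw [hDTs]
      have := norm_le_norm_add_norm_sub ((fderiv ℝ (Φ^[T - Ts]) p w)) ((saddleLin lu ^ (T - Ts)) w)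
      rw [hA] at this
      linarith
    have hpow : lu ^ (T - Ts) = lu ^ Te * lu ^ j := by rw [← pow_add]; congr 1; omega
    rw [hpow] at hdenb
    set X := ‖fderiv ℝ (Φ^[j]) ζ‖ with hXdef
    have hX : 0 ≤ X := ContinuousLinearMap.opNorm_nonneg _
    refine div_le_of_le_mul₀ (norm_nonneg _) (by positivity) (hnumb.trans ?_)
    refine (passage_ratio_le hT3r hX (by positivity) (pow_pos h0 j)).trans ?_
    rw [mul_right_comm (lu ^ Te)] at hdenb
    gcongr
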